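/- Let $a<b$ and let $f:[a,b]\to\mathbb{R}$ be four times continuously differentiable with $|f''(a)|+|f''(b)|>0$ (one-sided derivatives at the end points). For $n\ge 4$ and knots $a=x_0<x_1<\dots<x_n=b$ put $h:=\max_{1\le i\le n}(x_i-x_{i-1})$. The natural spline for $f$ on these knots is the function $s\in C^2([a,b])$ that is a polynomial of degree at most $3$ on each $[x_{i-1},x_i]$, with $s(x_i)=f(x_i)$ for $0\le i\le n$ and $s''(a)=s''(b)=0$; it exists and is unique. Its interpolation error is of the exact order $h^2$, in the following sense. (1) Upper bound: there is a constant $C>0$, depending only on $a,b,f$, such that for all $n\ge4$ and all such knots $\max_{t\in[a,b]}|s(t)-f(t)|\le C\,h^2$. (2) Lower bound: there are constants $c>0$, $h_0>0$, depending only on $a,b,f$, such that for all $n\ge 4$ and all such knots with $h\le h_0$: if $f''(a)\ne0$ then $\max_{t\in[x_0,x_1]}|s(t)-f(t)|\ge c\,(x_1-x_0)^2$, and if $f''(b)\ne 0$ then $\max_{t\in[x_{n-1},x_n]}|s(t)-f(t)|\ge c\,(x_n-x_{n-1})^2$. (3) Exact order: the worst-case error $E(h)$, that is, the supremum of $\max_{t\in[a,b]}|s(t)-f(t)|$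 over all $n\ge 4$ and all such knots with $\max_{1\le i\le n}(x_i-x_{i-1})=h$, satisfies $E(h)=\Theta(h^2)$ as $h\to0^+$. -/

import Mathlib

open Set Filter Topology Asymptotics

/-- `x 0 < x 1 < ⋯ < x n` are knots with `x 0 = a` and `x n = b`
(the values `x i` with `i > n` play no role). -/
structure IsMesh (a b : ℝ) (n : ℕ) (x : ℕ → ℝ) : Prop where
  left : x 0 = a
  right : x n = b
  lt : ∀ i < n, x i < x (i + 1)

/-- The mesh size `h = max_{1 ≤ i ≤ n} (x i - x (i - 1))`. -/
noncomputable def meshSize (n : ℕ) (x : ℕ → ℝ) : ℝ :=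
  ⨆ i : Fin n, (x (i + 1) - x i)

/-- The second derivative, at `t`, of a function on `[a, b]` (one-sided at the end points). -/
noncomputable def secondDeriv (a b : ℝ) (g : ℝ → ℝ) (t : ℝ) : ℝ :=
  iteratedDerivWithin 2 g (Icc a b) t

/-- `s` is a cubic spline on `[a, b]` with knots `x 0, …, x n`: it is twice continuously
differentiable on `[a, b]` and is a polynomial of degree at most three between
consecutive knots. -/
structure IsCubicSpline (a b : ℝ) (n : ℕ) (x : ℕ → ℝ) (s : ℝ → ℝ) : Prop where
  contDiffOn : ContDiffOn ℝ 2 s (Icc a b)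
  cubic : ∀ i < n, ∃ p : Polynomial ℝ, p.natDegree ≤ 3 ∧
    ∀ t ∈ Icc (x i) (x (i + 1)), s t = p.eval t

/-- `s` is the natural cubic spline interpolating `f` at the knots `x 0, …, x n` of `[a, b]`:
its second derivative vanishes at both end points. -/
structure IsNaturalSpline (a b : ℝ) (n : ℕ) (x : ℕ → ℝ) (f s : ℝ → ℝ) : Prop where
  spline : IsCubicSpline a b n x s
  interp : ∀ i ≤ n, s (x i) = f (x i)
  natural_left : secondDeriv a b s a = 0
  natural_right : secondDeriv a b s b = 0

/-- The maximal error `max_{t ∈ [u, v]} |s t - f t|`. -/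
noncomputable def maxError (u v : ℝ) (f s : ℝ → ℝ) : ℝ :=
  ⨆ t : Icc u v, |s t - f t|

/-- The worst-case error `sup ‖s - f‖_∞` of natural spline interpolation of `f` on `[a, b]`, over
all sets of knots with mesh size exactly `h` and at least five knots. -/
noncomputable def worstError (a b : ℝ) (f : ℝ → ℝ) (h : ℝ) : ℝ :=
  sSup {e : ℝ | ∃ (n : ℕ) (x : ℕ → ℝ) (s : ℝ → ℝ), 4 ≤ n ∧ IsMesh a b n x ∧ meshSize n x = h ∧
    IsNaturalSpline a b n x f s ∧ e = maxError a b f s}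

/-! Upper bound: the values of `s''` at the knots (the moments) solve a tridiagonal, diagonally
dominant system whose right side is controlled by a bound `K` for `|f''|`. Looking at the moment of
largest modulus gives `|s''| ≤ 3K` at every knot (`IsNaturalSpline.abs_secondDeriv_le`). On each
interval both `s` and `f` then stay within `O(K h^2)` of their common chord
(`IsNaturalSpline.abs_sub_le`). With `K = 0` this is uniqueness; existence follows by shooting from
the left end.

Lower bound: on cubics, `2g(p) - 5g(p+k) + 4g(p+2k) - g(p+3k)` equals `k^2 g''(p)`. At an end point
`p`, with `3k` the signed length of the end interval, it vanishes for `s` but is `k^2 f''(p) +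
o(k^2)` for `f`. As `s = f` at `p` and `p+3k`, the error at the two inner points must be of order
`k^2` (`exists_le_error_of_four_point_eq_zero`). Meshes of size `h` whose end interval has length
exactly `h` turn this into the lower half of `worstError_isTheta`. -/

/-! ### Cubic polynomials and one-sided derivatives. -/

theorem Polynomial.exists_eval_eq_of_natDegree_le_three {p : Polynomial ℝ} (hp : p.natDegree ≤ 3) :
    ∃ c₀ c₁ c₂ c₃ : ℝ, ∀ t : ℝ,
      p.eval t = c₀ + c₁ * t + c₂ * t ^ 2 + c₃ * t ^ 3 ∧
      p.derivative.eval t = c₁ + 2 * c₂ * t + 3 * c₃ * t ^ 2 ∧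
      p.derivative.derivative.eval t = 2 * c₂ + 6 * c₃ * t := by
  refine ⟨p.coeff 0, p.coeff 1, p.coeff 2, p.coeff 3, fun t => ?_⟩
  have h := p.as_sum_range_C_mul_X_pow' (Nat.lt_succ_of_le hp)
  generalize p.coeff = c at h
  subst h
  simp [Finset.sum_range_succ]
  refine ⟨?_, ?_⟩ <;> ring

/-- A derivative within `D` is also one within `E`, where it is unique. At a knot this lets the same
derivative be read off from either adjacent cubic piece. -/
theorem derivWithin_eqOn_polynomial {D E : Set ℝ} (hE : UniqueDiffOn ℝ E) (hsub : E ⊆ D)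
    {s : ℝ → ℝ} {p : Polynomial ℝ} (hs : DifferentiableOn ℝ s D)
    (h : EqOn s (fun t => p.eval t) E) :
    EqOn (derivWithin s D) (fun t => p.derivative.eval t) E := fun t ht =>
  (hE t ht).eq_deriv E ((hs t (hsub ht)).hasDerivWithinAt.mono hsub)
    ((p.hasDerivAt t).hasDerivWithinAt.congr h (h ht))

theorem secondDeriv_eq_derivWithin (a b : ℝ) (s : ℝ → ℝ) :
    secondDeriv a b s = derivWithin (derivWithin s (Icc a b)) (Icc a b) := by
  funext t
  rw [secondDeriv, iteratedDerivWithin_succ, iteratedDerivWithin_one]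

theorem differentiableOn_derivWithin_Icc {a b : ℝ} (hab : a < b) {s : ℝ → ℝ}
    (hs : ContDiffOn ℝ 2 s (Icc a b)) :
    DifferentiableOn ℝ (derivWithin s (Icc a b)) (Icc a b) := by
  rw [← iteratedDerivWithin_one]
  exact hs.differentiableOn_iteratedDerivWithin (by norm_num) (uniqueDiffOn_Icc hab)

theorem secondDeriv_eqOn_polynomial {a b u v : ℝ} (hab : a < b) (huv : u < v)
    (hsub : Icc u v ⊆ Icc a b) {s : ℝ → ℝ} {p : Polynomial ℝ} (hs : ContDiffOn ℝ 2 s (Icc a b))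
    (h : EqOn s (fun t => p.eval t) (Icc u v)) :
    EqOn (secondDeriv a b s) (fun t => p.derivative.derivative.eval t) (Icc u v) := by
  rw [secondDeriv_eq_derivWithin]
  exact derivWithin_eqOn_polynomial (uniqueDiffOn_Icc huv) hsub
    (differentiableOn_derivWithin_Icc hab hs)
    (derivWithin_eqOn_polynomial (uniqueDiffOn_Icc huv) hsub (hs.differentiableOn (by norm_num)) h)

theorem secondDeriv_sub {a b t : ℝ} (hab : a < b) (ht : t ∈ Icc a b) {f g : ℝ → ℝ}
    (hf : ContDiffOn ℝ 2 f (Icc a b)) (hg : ContDiffOn ℝ 2 g (Icc a b)) :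
    secondDeriv a b (f - g) t = secondDeriv a b f t - secondDeriv a b g t :=
  iteratedDerivWithin_sub ht (uniqueDiffOn_Icc hab) (hf t ht) (hg t ht)

theorem secondDeriv_const_mul {a b : ℝ} (t c : ℝ) (f : ℝ → ℝ) :
    secondDeriv a b (fun t => c * f t) t = c * secondDeriv a b f t :=
  iteratedDerivWithin_const_mul_field c f

/-! ### Meshes. -/

namespace IsMesh

variable {a b : ℝ} {n : ℕ} {x : ℕ → ℝ}

theorem le_of_le (hx : IsMesh a b n x) {i j : ℕ} (hij : i ≤ j) (hj : j ≤ n) : x i ≤ x j := by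
  induction j, hij using Nat.le_induction with
  | base => exact le_rfl
  | succ j hij ih => exact (ih (by omega)).trans (hx.lt j (by omega)).le

theorem mem_Icc (hx : IsMesh a b n x) {i : ℕ} (hi : i ≤ n) : x i ∈ Icc a b :=
  ⟨hx.left ▸ hx.le_of_le (Nat.zero_le i) hi, hx.right ▸ hx.le_of_le hi le_rfl⟩

theorem Icc_subset (hx : IsMesh a b n x) {i : ℕ} (hi : i < n) :
    Icc (x i) (x (i + 1)) ⊆ Icc a b :=
  Icc_subset_Icc (hx.mem_Icc hi.le).1 (hx.mem_Icc hi).2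

theorem exists_mem_Icc (hx : IsMesh a b n x) (hn : 0 < n) {t : ℝ} (ht : t ∈ Icc a b) :
    ∃ i < n, t ∈ Icc (x i) (x (i + 1)) := by
  have key : ∀ m, 0 < m → m ≤ n → t ≤ x m → ∃ i < n, t ∈ Icc (x i) (x (i + 1)) := by
    intro m hm
    induction m, hm using Nat.le_induction with
    | base => exact fun h h' => ⟨0, by omega, hx.left ▸ ht.1, h'⟩
    | succ m hm ih =>
      intro h h'
      rcases le_total t (x m) with h2 | h2
      · exact ih (by omega) h2
      · exact ⟨m, by omega, h2, h'⟩
  exact key n hn le_rfl (hx.right ▸ ht.2)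

theorem sub_le_meshSize (n : ℕ) (x : ℕ → ℝ) {i : ℕ} (hi : i < n) :
    x (i + 1) - x i ≤ meshSize n x :=
  le_ciSup (f := fun i : Fin n => x (i + 1) - x i) (finite_range _).bddAbove ⟨i, hi⟩

end IsMesh

/-! ### Curvature bounds and distance from the chord. -/

/-- The second derivative of `f` on `[a, b]` is bounded by `K` in absolute value, expressed
without derivatives. -/
structure HasCurvatureBound (a b K : ℝ) (f : ℝ → ℝ) : Prop where
  convex_add : ConvexOn ℝ (Icc a b) (fun t => K / 2 * t ^ 2 + f t)
  convex_sub : ConvexOn ℝ (Icc a b) (fun t => K / 2 * t ^ 2 - f t)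

theorem ConvexOn.chord_le {D : Set ℝ} {g : ℝ → ℝ} (hg : ConvexOn ℝ D g) {u t v : ℝ}
    (hu : u ∈ D) (hv : v ∈ D) (hut : u ≤ t) (htv : t ≤ v) :
    (v - u) * g t ≤ (v - t) * g u + (t - u) * g v := by
  rcases hut.eq_or_lt with rfl | h1
  · simp
  rcases htv.eq_or_lt with rfl | h2
  · simp
  have h := hg.slope_mono_adjacent hu hv h1 h2
  rw [div_le_div_iff₀ (by linarith) (by linarith)] at h
  linarith

/-- The right side is the chord defect of `K / 2 * t ^ 2`, so the two convexity inequalities are the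
two signs of the absolute value. -/
theorem HasCurvatureBound.abs_chord_le {a b K : ℝ} {f : ℝ → ℝ} (hf : HasCurvatureBound a b K f)
    {u t v : ℝ} (hu : u ∈ Icc a b) (hv : v ∈ Icc a b) (hut : u ≤ t) (htv : t ≤ v) :
    |(v - u) * f t - (v - t) * f u - (t - u) * f v| ≤ K / 2 * ((v - u) * ((t - u) * (v - t))) := by
  have h1 := hf.convex_add.chord_le hu hv hut htv
  have h2 := hf.convex_sub.chord_le hu hv hut htv
  rw [abs_le]
  constructor <;> nlinarith

theorem hasCurvatureBound_zero (a b : ℝ) : HasCurvatureBound a b 0 (fun _ => 0) := by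
  constructor <;> simpa using convexOn_const (0 : ℝ) (convex_Icc a b)

theorem exists_hasCurvatureBound {a b : ℝ} (hab : a < b) {f : ℝ → ℝ}
    (hf : ContDiffOn ℝ 2 f (Icc a b)) : ∃ K : ℝ, 0 ≤ K ∧ HasCurvatureBound a b K f := by
  have hc : ContinuousOn (secondDeriv a b f) (Icc a b) :=
    hf.continuousOn_iteratedDerivWithin (by norm_num) (uniqueDiffOn_Icc hab)
  obtain ⟨K, hK⟩ := isCompact_Icc.exists_bound_of_continuousOn hc
  simp only [Real.norm_eq_abs, abs_le] at hK
  have hd : ∀ t ∈ interior (Icc a b),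
      HasDerivWithinAt f (derivWithin f (Icc a b) t) (interior (Icc a b)) t := fun t ht =>
    ((hf.differentiableOn (by norm_num)) t (interior_subset ht)).hasDerivWithinAt.mono
      interior_subset
  have hd2 : ∀ t ∈ interior (Icc a b),
      HasDerivWithinAt (derivWithin f (Icc a b)) (secondDeriv a b f t)
        (interior (Icc a b)) t := fun t ht => by
    rw [secondDeriv_eq_derivWithin]
    exact (differentiableOn_derivWithin_Icc hab hf t (interior_subset ht)).hasDerivWithinAt.mono
      interior_subset
  have hq : ∀ t : ℝ, HasDerivWithinAt (fun t : ℝ => K / 2 * t ^ 2) (K * t)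
      (interior (Icc a b)) t := fun t => by
    have := ((hasDerivAt_pow 2 t).const_mul (K / 2)).hasDerivWithinAt (s := interior (Icc a b))
    exact this.congr_deriv (by norm_num; ring)
  have hq2 : ∀ t : ℝ, HasDerivWithinAt (fun t : ℝ => K * t) K (interior (Icc a b)) t := fun t => by
    simpa using ((hasDerivAt_id t).const_mul K).hasDerivWithinAt (s := interior (Icc a b))
  refine ⟨K, ?_, ?_, ?_⟩
  · have := hK a (left_mem_Icc.2 hab.le); linarith
  · refine convexOn_of_hasDerivWithinAt2_nonneg (convex_Icc a b)
      ((by fun_prop : Continuous fun t : ℝ => K / 2 * t ^ 2).continuousOn.add hf.continuousOn)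
      (fun t ht => (hq t).add (hd t ht)) (fun t ht => (hq2 t).add (hd2 t ht)) fun t ht => ?_
    have := hK t (interior_subset ht); linarith
  · refine convexOn_of_hasDerivWithinAt2_nonneg (convex_Icc a b)
      ((by fun_prop : Continuous fun t : ℝ => K / 2 * t ^ 2).continuousOn.sub hf.continuousOn)
      (fun t ht => (hq t).sub (hd t ht)) (fun t ht => (hq2 t).sub (hd2 t ht)) fun t ht => ?_
    have := hK t (interior_subset ht); linarith

/-! ### Identities for cubic splines in terms of moments. -/

namespace IsCubicSpline

variable {a b : ℝ} {n : ℕ} {x : ℕ → ℝ} {s : ℝ → ℝ}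

theorem chord_eq (hs : IsCubicSpline a b n x s) (hab : a < b) (hx : IsMesh a b n x) {i : ℕ}
    (hi : i < n) {t : ℝ} (ht : t ∈ Icc (x i) (x (i + 1))) :
    (x (i + 1) - x i) * s t - (x (i + 1) - t) * s (x i) - (t - x i) * s (x (i + 1)) =
      -((t - x i) * (x (i + 1) - t) / 6 *
        (secondDeriv a b s (x i) * (x (i + 1) - x i + (x (i + 1) - t)) +
          secondDeriv a b s (x (i + 1)) * (x (i + 1) - x i + (t - x i)))) := by
  obtain ⟨p, hp, hsp⟩ := hs.cubic i hi
  have h2 := secondDeriv_eqOn_polynomial hab (hx.lt i hi) (hx.Icc_subset hi) hs.contDiffOn hsp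
  have hl := left_mem_Icc.2 (hx.lt i hi).le
  have hr := right_mem_Icc.2 (hx.lt i hi).le
  rw [h2 hl, h2 hr, hsp t ht, hsp _ hl, hsp _ hr]
  obtain ⟨c₀, c₁, c₂, c₃, hc⟩ := Polynomial.exists_eval_eq_of_natDegree_le_three hp
  simp only [hc]
  ring

theorem moment_eq (hs : IsCubicSpline a b n x s) (hab : a < b) (hx : IsMesh a b n x) {i : ℕ}
    (hi : i + 1 < n) :
    (x (i + 1) - x i) * (x (i + 2) - x (i + 1)) *
      ((x (i + 1) - x i) * secondDeriv a b s (x i) +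
        2 * (x (i + 2) - x i) * secondDeriv a b s (x (i + 1)) +
        (x (i + 2) - x (i + 1)) * secondDeriv a b s (x (i + 2))) =
      -6 * ((x (i + 2) - x i) * s (x (i + 1)) - (x (i + 2) - x (i + 1)) * s (x i) -
        (x (i + 1) - x i) * s (x (i + 2))) := by
  obtain ⟨p, hp, hsp⟩ := hs.cubic i (by omega)
  obtain ⟨q, hq, hsq⟩ := hs.cubic (i + 1) hi
  have l1 := hx.lt i (by omega)
  have l2 : x (i + 1) < x (i + 2) := hx.lt (i + 1) hi
  have s1 := hx.Icc_subset (i := i) (by omega)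
  have s2 := hx.Icc_subset hi
  have hd := hs.contDiffOn.differentiableOn (by norm_num)
  have e1 := derivWithin_eqOn_polynomial (uniqueDiffOn_Icc l1) s1 hd hsp (right_mem_Icc.2 l1.le)
  have e2 := derivWithin_eqOn_polynomial (uniqueDiffOn_Icc l2) s2 hd hsq (left_mem_Icc.2 l2.le)
  have p2 := secondDeriv_eqOn_polynomial hab l1 s1 hs.contDiffOn hsp
  have q2 := secondDeriv_eqOn_polynomial hab l2 s2 hs.contDiffOn hsq
  have hM := p2 (right_mem_Icc.2 l1.le)
  have hM' := q2 (left_mem_Icc.2 l2.le)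
  have hv := hsp _ (right_mem_Icc.2 l1.le)
  have hv' := hsq _ (left_mem_Icc.2 l2.le)
  have hM0 := p2 (left_mem_Icc.2 l1.le)
  have hM2 := q2 (right_mem_Icc.2 l2.le)
  have hv0 := hsp _ (left_mem_Icc.2 l1.le)
  have hv2 := hsq _ (right_mem_Icc.2 l2.le)
  rw [e1] at e2
  simp only [show i + 1 + 1 = i + 2 from rfl] at *
  obtain ⟨c₀, c₁, c₂, c₃, hc⟩ := Polynomial.exists_eval_eq_of_natDegree_le_three hp
  obtain ⟨d₀, d₁, d₂, d₃, hd⟩ := Polynomial.exists_eval_eq_of_natDegree_le_three hq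
  simp only [hc, hd] at *
  generalize secondDeriv a b s (x i) = M0 at *
  generalize secondDeriv a b s (x (i + 1)) = M1 at *
  generalize secondDeriv a b s (x (i + 2)) = M2 at *
  generalize s (x i) = f0 at *
  generalize s (x (i + 1)) = f1 at *
  generalize s (x (i + 2)) = f2 at *
  generalize x i = u at *
  generalize x (i + 1) = v at *
  generalize x (i + 2) = w at *
  subst hM0 hM2 hv0 hv2
  -- `k1` and `k2` express the slope at `v` through values and moments on the right and on the left;
  -- `e2` says that the two slopes agree.
  have k1 : 6 * (v - u) * (f1 - (d₀ + d₁ * w + d₂ * w ^ 2 + d₃ * w ^ 3)) +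
      6 * (v - u) * (w - v) * (d₁ + 2 * d₂ * v + 3 * d₃ * v ^ 2) +
      (v - u) * (w - v) ^ 2 * (2 * M1 + (2 * d₂ + 6 * d₃ * w)) = 0 := by
    rw [hM', hv']; ring
  have k2 : 6 * (w - v) * (f1 - (c₀ + c₁ * u + c₂ * u ^ 2 + c₃ * u ^ 3)) -
      6 * (w - v) * (v - u) * (c₁ + 2 * c₂ * v + 3 * c₃ * v ^ 2) +
      (w - v) * (v - u) ^ 2 * (2 * M1 + (2 * c₂ + 6 * c₃ * u)) = 0 := by
    rw [hM, hv]; ring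
  linear_combination k1 + k2 + 6 * (w - v) * (v - u) * e2

theorem sub {r : ℝ → ℝ} (hs : IsCubicSpline a b n x s) (hr : IsCubicSpline a b n x r) :
    IsCubicSpline a b n x (s - r) where
  contDiffOn := hs.contDiffOn.sub hr.contDiffOn
  cubic := fun i hi => by
    obtain ⟨p, hp, hp'⟩ := hs.cubic i hi
    obtain ⟨q, hq, hq'⟩ := hr.cubic i hi
    refine ⟨p - q, (Polynomial.natDegree_sub_le p q).trans (max_le hp hq), fun t ht => ?_⟩
    simp [hp' t ht, hq' t ht]

theorem const_mul (hs : IsCubicSpline a b n x s) (c : ℝ) :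
    IsCubicSpline a b n x (fun t => c * s t) where
  contDiffOn := contDiffOn_const.mul hs.contDiffOn
  cubic := fun i hi => by
    obtain ⟨p, hp, hp'⟩ := hs.cubic i hi
    refine ⟨Polynomial.C c * p, (Polynomial.natDegree_C_mul_le c p).trans hp, fun t ht => ?_⟩
    simp [hp' t ht]

end IsCubicSpline

/-! ### Moment bound, error bound and uniqueness. -/

namespace IsNaturalSpline

variable {a b K : ℝ} {n : ℕ} {x : ℕ → ℝ} {f s : ℝ → ℝ}

/-- Discrete maximum principle: at an interior knot with the largest moment, the diagonal weight
`2(h + h')` beats the off-diagonal weights `h` and `h'` by `h + h'`. At an end knot the moment is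
zero. -/
theorem abs_secondDeriv_le (hs : IsNaturalSpline a b n x f s) (hab : a < b) (hK : 0 ≤ K)
    (hf : HasCurvatureBound a b K f) (hx : IsMesh a b n x) {i : ℕ} (hi : i ≤ n) :
    |secondDeriv a b s (x i)| ≤ 3 * K := by
  obtain ⟨j, hj, hmax⟩ := Finset.exists_max_image (Finset.range (n + 1))
    (fun j => |secondDeriv a b s (x j)|) ⟨0, by simp⟩
  simp only [Finset.mem_range, Nat.lt_succ_iff] at hj hmax
  refine (hmax i hi).trans ?_
  rcases j.eq_zero_or_pos with rfl | hj0
  · rw [hx.left, hs.natural_left, abs_zero]; positivity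
  rcases hj.eq_or_lt with rfl | hjn
  · rw [hx.right, hs.natural_right, abs_zero]; positivity
  obtain ⟨j, rfl⟩ : ∃ m, j = m + 1 := ⟨j - 1, by omega⟩
  have l1 := hx.lt j (by omega)
  have l2 : x (j + 1) < x (j + 2) := hx.lt (j + 1) hjn
  have hm := hs.spline.moment_eq hab hx hjn
  have hc := hf.abs_chord_le (hx.mem_Icc (i := j) (by omega)) (hx.mem_Icc (i := j + 2) hjn)
    l1.le l2.le
  have m0 := hmax j (by omega)
  have m2 := hmax (j + 2) (by omega)
  rw [hs.interp j (by omega), hs.interp (j + 1) hj, hs.interp (j + 2) hjn] at hm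
  generalize secondDeriv a b s (x j) = M0 at *
  generalize secondDeriv a b s (x (j + 1)) = M1 at *
  generalize secondDeriv a b s (x (j + 2)) = M2 at *
  set h := x (j + 1) - x j with hh
  set h' := x (j + 2) - x (j + 1) with hh'
  have hsum : x (j + 2) - x j = h + h' := by rw [hh, hh']; ring
  rw [hsum] at hm hc
  have p1 : 0 < h := sub_pos.2 l1
  have p2 : 0 < h' := sub_pos.2 l2
  have hS : |h * M0 + 2 * (h + h') * M1 + h' * M2| ≤ 3 * K * (h + h') := by
    have e := congrArg abs hm
    rw [abs_mul, abs_mul (-6 : ℝ), abs_of_pos (mul_pos p1 p2), abs_neg,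
      abs_of_pos (by norm_num : (0 : ℝ) < 6)] at e
    refine le_of_mul_le_mul_left ?_ (mul_pos p1 p2)
    rw [e]
    linarith
  have t : 2 * (h + h') * |M1| ≤ 3 * K * (h + h') + h * |M0| + h' * |M2| := by
    calc 2 * (h + h') * |M1| = |(h * M0 + 2 * (h + h') * M1 + h' * M2) - h * M0 - h' * M2| := by
          rw [show (h * M0 + 2 * (h + h') * M1 + h' * M2) - h * M0 - h' * M2 =
            2 * (h + h') * M1 by ring, abs_mul, abs_of_pos (by positivity : 0 < 2 * (h + h'))]
      _ ≤ |h * M0 + 2 * (h + h') * M1 + h' * M2| + |h * M0| + |h' * M2| :=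
          (abs_sub _ _).trans (by gcongr; exact abs_sub _ _)
      _ ≤ _ := by rw [abs_mul h, abs_mul h', abs_of_pos p1, abs_of_pos p2]; gcongr
  refine le_of_mul_le_mul_left ?_ (add_pos p1 p2)
  nlinarith [mul_le_mul_of_nonneg_left m0 p1.le, mul_le_mul_of_nonneg_left m2 p2.le]

theorem abs_sub_le (hs : IsNaturalSpline a b n x f s) (hab : a < b) (hK : 0 ≤ K)
    (hf : HasCurvatureBound a b K f) (hn : 0 < n) (hx : IsMesh a b n x) {t : ℝ}
    (ht : t ∈ Icc a b) : |s t - f t| ≤ K * meshSize n x ^ 2 := by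
  obtain ⟨i, hi, hti⟩ := hx.exists_mem_Icc hn ht
  have hlt := hx.lt i hi
  have hm := IsMesh.sub_le_meshSize n x hi
  have hc := hf.abs_chord_le (hx.mem_Icc hi.le) (hx.mem_Icc hi) hti.1 hti.2
  have hsc := hs.spline.chord_eq hab hx hi hti
  rw [hs.interp i hi.le, hs.interp (i + 1) hi] at hsc
  have M0 := hs.abs_secondDeriv_le hab hK hf hx hi.le
  have M1 := hs.abs_secondDeriv_le hab hK hf hx hi
  generalize secondDeriv a b s (x i) = A at *
  generalize secondDeriv a b s (x (i + 1)) = B at *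
  obtain ⟨h1, h2⟩ := hti
  generalize x i = u at *
  generalize x (i + 1) = v at *
  have hb : |A * (v - u + (v - t)) + B * (v - u + (t - u))| ≤ 9 * K * (v - u) := by
    refine (abs_add_le _ _).trans ?_
    rw [abs_mul, abs_mul, abs_of_nonneg (by linarith : 0 ≤ v - u + (v - t)),
      abs_of_nonneg (by linarith : 0 ≤ v - u + (t - u))]
    nlinarith [mul_le_mul_of_nonneg_right M0 (by linarith : 0 ≤ v - u + (v - t)),
      mul_le_mul_of_nonneg_right M1 (by linarith : 0 ≤ v - u + (t - u))]
  have hw : 0 ≤ (t - u) * (v - t) := mul_nonneg (by linarith) (by linarith)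
  have hsb : |(v - u) * s t - (v - t) * f u - (t - u) * f v| ≤
      (t - u) * (v - t) / 6 * (9 * K * (v - u)) := by
    rw [hsc, abs_neg, abs_mul, abs_of_nonneg (by positivity)]
    gcongr
  -- The factor `2` is `9 / 6` from the chord defect of `s` plus `1 / 2` from that of `f`.
  have hd : (v - u) * |s t - f t| ≤ 2 * K * ((v - u) * ((t - u) * (v - t))) := by
    rw [← abs_of_pos (sub_pos.2 hlt), ← abs_mul, abs_of_pos (sub_pos.2 hlt)]
    calc |(v - u) * (s t - f t)| = |((v - u) * s t - (v - t) * f u - (t - u) * f v) -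
          ((v - u) * f t - (v - t) * f u - (t - u) * f v)| := by congr 1; ring
      _ ≤ _ := (abs_sub _ _).trans (by linarith)
  have hd' : |s t - f t| ≤ 2 * K * ((t - u) * (v - t)) :=
    le_of_mul_le_mul_left (by linarith) (sub_pos.2 hlt)
  refine hd'.trans ?_
  have hq : 2 * ((t - u) * (v - t)) ≤ meshSize n x ^ 2 := by
    have : (v - u) ^ 2 ≤ meshSize n x ^ 2 := pow_le_pow_left₀ (by linarith) hm 2
    nlinarith [sq_nonneg ((t - u) - (v - t)), sq_nonneg (v - u)]
  nlinarith [mul_le_mul_of_nonneg_left hq hK]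

theorem sub {g r : ℝ → ℝ} (hs : IsNaturalSpline a b n x f s) (hr : IsNaturalSpline a b n x g r)
    (hab : a < b) : IsNaturalSpline a b n x (fun t => f t - g t) (s - r) where
  spline := hs.spline.sub hr.spline
  interp := fun i hi => by simp [hs.interp i hi, hr.interp i hi]
  natural_left := by
    rw [secondDeriv_sub hab (left_mem_Icc.2 hab.le) hs.spline.contDiffOn hr.spline.contDiffOn,
      hs.natural_left, hr.natural_left, sub_zero]
  natural_right := by
    rw [secondDeriv_sub hab (right_mem_Icc.2 hab.le) hs.spline.contDiffOn hr.spline.contDiffOn,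
      hs.natural_right, hr.natural_right, sub_zero]

theorem eqOn_zero (hs : IsNaturalSpline a b n x (fun _ => 0) s) (hab : a < b) (hn : 0 < n)
    (hx : IsMesh a b n x) : EqOn s 0 (Icc a b) := fun t ht => by
  simpa using hs.abs_sub_le hab le_rfl (hasCurvatureBound_zero a b) hn hx ht

theorem eqOn {r : ℝ → ℝ} (hs : IsNaturalSpline a b n x f s) (hr : IsNaturalSpline a b n x f r)
    (hab : a < b) (hn : 0 < n) (hx : IsMesh a b n x) : EqOn s r (Icc a b) := fun t ht => by
  have h := hs.sub hr hab
  simp only [sub_self] at h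
  simpa [sub_eq_zero] using h.eqOn_zero hab hn hx ht

end IsNaturalSpline

/-! ### Existence by shooting. -/

theorem hasDerivAt_max_sub_zero_pow (c t : ℝ) (k : ℕ) :
    HasDerivAt (fun t : ℝ => max (t - c) 0 ^ (k + 2)) ((k + 2) * max (t - c) 0 ^ (k + 1)) t := by
  have hr : ∀ t, HasDerivAt (fun t : ℝ => (t - c) ^ (k + 2)) ((k + 2) * (t - c) ^ (k + 1)) t :=
    fun t => (((hasDerivAt_id t).sub_const c).pow (k + 2)).congr_deriv (by simp)
  rcases lt_trichotomy t c with h | rfl | h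
  · rw [max_eq_right (by linarith), zero_pow (by omega), mul_zero]
    refine (hasDerivAt_const t (0 : ℝ)).congr_of_eventuallyEq ?_
    filter_upwards [Iio_mem_nhds h] with y hy
    rw [max_eq_right (by linarith [mem_Iio.1 hy]), zero_pow (by omega)]
  · have h1 : HasDerivWithinAt (fun y : ℝ => max (y - t) 0 ^ (k + 2)) 0 (Iic t) t :=
      (hasDerivWithinAt_const t (Iic t) (0 : ℝ)).congr
        (fun y hy => by rw [max_eq_right (by linarith [mem_Iic.1 hy]), zero_pow (by omega)])
        (by simp)
    have h2 : HasDerivWithinAt (fun y : ℝ => max (y - t) 0 ^ (k + 2)) 0 (Ici t) t :=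
      ((hr t).hasDerivWithinAt.congr_deriv (by simp)).congr
        (fun y hy => by rw [max_eq_left (by linarith [mem_Ici.1 hy])]) (by simp)
    have h3 := h1.union h2
    rw [Iic_union_Ici, hasDerivWithinAt_univ] at h3
    simpa using h3
  · rw [max_eq_left (by linarith)]
    refine (hr t).congr_of_eventuallyEq ?_
    filter_upwards [Ioi_mem_nhds h] with y hy
    rw [max_eq_left (by linarith [mem_Ioi.1 hy])]

theorem contDiff_max_sub_zero_pow_three (c : ℝ) :
    ContDiff ℝ 2 (fun t : ℝ => max (t - c) 0 ^ 3) := by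
  have h1 := fun t => hasDerivAt_max_sub_zero_pow c t 1
  have h2 := fun t => (hasDerivAt_max_sub_zero_pow c t 0).const_mul (((1 : ℕ) : ℝ) + 2)
  rw [show (2 : WithTop ℕ∞) = 1 + 1 by norm_num, contDiff_succ_iff_deriv]
  refine ⟨fun t => (h1 t).differentiableAt, by simp, ?_⟩
  rw [show deriv (fun t : ℝ => max (t - c) 0 ^ 3) = _ from funext fun t => (h1 t).deriv,
    contDiff_one_iff_deriv]
  refine ⟨fun t => (h2 t).differentiableAt, ?_⟩
  rw [show deriv (fun t : ℝ => (((1 : ℕ) : ℝ) + 2) * max (t - c) 0 ^ (1 + 1)) = _ from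
    funext fun t => (h2 t).deriv]
  fun_prop

theorem natDegree_add_C_mul_X_sub_C_pow_three_le {p : Polynomial ℝ} (hp : p.natDegree ≤ 3)
    (c d : ℝ) :
    (p + Polynomial.C d * (Polynomial.X - Polynomial.C c) ^ 3).natDegree ≤ 3 := by
  refine (Polynomial.natDegree_add_le _ _).trans (max_le hp ?_)
  refine (Polynomial.natDegree_C_mul_le _ _).trans (Polynomial.natDegree_pow_le.trans ?_)
  simp

/-- Adding a multiple of the truncated cube at `x m` preserves `C^2` and everything to the left of
`x m`, and can correct the value at `x (m + 1)`. The induction needs a single cubic on all of `[x m,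
∞)`. Being affine left of `a` fixes the slope and a zero second derivative at `a`. -/
theorem exists_interpolating_spline_of_slope {a b : ℝ} {n : ℕ} {x : ℕ → ℝ} (hx : IsMesh a b n x)
    (f : ℝ → ℝ) (c : ℝ) {m : ℕ} (hm : m ≤ n) :
    ∃ s : ℝ → ℝ, ContDiff ℝ 2 s ∧ (∀ t ≤ a, s t = f a + c * (t - a)) ∧
      (∀ i < m, ∃ p : Polynomial ℝ, p.natDegree ≤ 3 ∧
        ∀ t ∈ Icc (x i) (x (i + 1)), s t = p.eval t) ∧
      (∃ p : Polynomial ℝ, p.natDegree ≤ 3 ∧ ∀ t, x m ≤ t → s t = p.eval t) ∧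
      ∀ i ≤ m, s (x i) = f (x i) := by
  induction m with
  | zero =>
    refine ⟨fun t => f a + c * (t - a), by fun_prop, fun t _ => rfl, by simp,
      ⟨Polynomial.C (f a) + Polynomial.C c * (Polynomial.X - Polynomial.C a), ?_, by simp⟩, ?_⟩
    · compute_degree!
    · intro i hi
      obtain rfl : i = 0 := by omega
      simp [hx.left]
  | succ m ih =>
    obtain ⟨s, h1, h2, h3, ⟨p, hp, hp'⟩, h5⟩ := ih (by omega)
    have hlt := hx.lt m hm
    have hcube : (x (m + 1) - x m) ^ 3 ≠ 0 := pow_ne_zero _ (sub_pos.2 hlt).ne'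
    set d := (f (x (m + 1)) - s (x (m + 1))) / (x (m + 1) - x m) ^ 3 with hd
    have hleft : ∀ t ≤ x m, s t + d * max (t - x m) 0 ^ 3 = s t := fun t ht => by
      rw [max_eq_right (by linarith)]; simp
    have hright : ∀ t, x m ≤ t → s t + d * max (t - x m) 0 ^ 3 =
        (p + Polynomial.C d * (Polynomial.X - Polynomial.C (x m)) ^ 3).eval t := fun t ht => by
      rw [max_eq_left (by linarith), hp' t ht]; simp
    have hdeg := natDegree_add_C_mul_X_sub_C_pow_three_le hp (x m) d
    refine ⟨fun t => s t + d * max (t - x m) 0 ^ 3,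
      h1.add (contDiff_const.mul (contDiff_max_sub_zero_pow_three _)), fun t ht => ?_,
      fun i hi => ?_, ⟨_, hdeg, fun t ht => hright t (hlt.le.trans ht)⟩, fun i hi => ?_⟩
    · exact (hleft t (ht.trans (hx.mem_Icc (by omega)).1)).trans (h2 t ht)
    · rcases Nat.lt_succ_iff_lt_or_eq.1 hi with hi | rfl
      · obtain ⟨q, hq, hq'⟩ := h3 i hi
        exact ⟨q, hq, fun t ht => (hleft t (ht.2.trans (hx.le_of_le hi (by omega)))).trans
          (hq' t ht)⟩
      · exact ⟨_, hdeg, fun t ht => hright t ht.1⟩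
    · rcases hi.lt_or_eq with hi | rfl
      · exact (hleft _ (hx.le_of_le (by omega) (by omega))).trans (h5 i (by omega))
      · simp only []
        rw [max_eq_left (sub_pos.2 hlt).le, hd, div_mul_cancel₀ _ hcube]
        ring

theorem secondDeriv_left_eq_zero_of_affine {a b c d : ℝ} (hab : a < b) {s : ℝ → ℝ}
    (hs : ContDiff ℝ 2 s) (h : ∀ t ≤ a, s t = d + c * (t - a)) : secondDeriv a b s a = 0 := by
  have h1 : secondDeriv a b s a = secondDeriv (a - 1) a s a := by
    rw [secondDeriv, secondDeriv,
      iteratedDerivWithin_eq_iteratedDeriv (uniqueDiffOn_Icc hab) hs.contDiffAt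
        (left_mem_Icc.2 hab.le),
      iteratedDerivWithin_eq_iteratedDeriv (uniqueDiffOn_Icc (by linarith)) hs.contDiffAt
        (right_mem_Icc.2 (by linarith))]
  rw [h1, secondDeriv_eqOn_polynomial (by linarith) (by linarith) Subset.rfl hs.contDiffOn
    (p := Polynomial.C d + Polynomial.C c * (Polynomial.X - Polynomial.C a))
    (fun t ht => by simp [h t ht.2]) (right_mem_Icc.2 (by linarith))]
  simp

/-- `g` interpolates `f` with initial slope `0` and `z` interpolates zero with initial slope `1`; a
multiple of `z` is subtracted from `g` to cancel the second derivative at `b`. -/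
theorem exists_isNaturalSpline {a b : ℝ} (hab : a < b) {n : ℕ} (hn : 0 < n) {x : ℕ → ℝ}
    (hx : IsMesh a b n x) (f : ℝ → ℝ) : ∃ s, IsNaturalSpline a b n x f s := by
  obtain ⟨g, g1, g2, g3, -, g5⟩ := exists_interpolating_spline_of_slope hx f 0 le_rfl
  obtain ⟨z, z1, z2, z3, -, z5⟩ := exists_interpolating_spline_of_slope hx (fun _ => 0) 1 le_rfl
  have gs : IsCubicSpline a b n x g := ⟨g1.contDiffOn, g3⟩
  have zs : IsCubicSpline a b n x z := ⟨z1.contDiffOn, z3⟩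
  have ga := secondDeriv_left_eq_zero_of_affine hab g1 g2
  have za := secondDeriv_left_eq_zero_of_affine hab z1 z2
  -- Otherwise `z` would be the natural spline of zero, hence zero on `[a, b]`, against its slope
  -- `1` at `a`.
  have zb : secondDeriv a b z b ≠ 0 := fun hzb => by
    have hz : IsNaturalSpline a b n x (fun _ => 0) z := ⟨zs, z5, za, hzb⟩
    have hd : DifferentiableOn ℝ z univ := (z1.differentiable (by norm_num)).differentiableOn
    have e1 := derivWithin_eqOn_polynomial (uniqueDiffOn_Icc hab) (subset_univ _) hd
      (p := 0) (fun t ht => by simpa using hz.eqOn_zero hab hn hx ht) (left_mem_Icc.2 hab.le)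
    have e2 := derivWithin_eqOn_polynomial (uniqueDiffOn_Icc (sub_one_lt a)) (subset_univ _) hd
      (p := Polynomial.X - Polynomial.C a) (fun t ht => by simp [z2 t ht.2])
      (right_mem_Icc.2 (sub_one_lt a).le)
    rw [e1] at e2
    simp at e2
  set q := secondDeriv a b g b / secondDeriv a b z b with hq
  have hzs := zs.const_mul q
  refine ⟨g - fun t => q * z t, gs.sub hzs, fun i hi => by simp [g5 i hi, z5 i hi], ?_, ?_⟩
  · rw [secondDeriv_sub hab (left_mem_Icc.2 hab.le) gs.contDiffOn hzs.contDiffOn,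
      secondDeriv_const_mul, ga, za]
    simp
  · rw [secondDeriv_sub hab (right_mem_Icc.2 hab.le) gs.contDiffOn hzs.contDiffOn,
      secondDeriv_const_mul, hq, div_mul_cancel₀ _ zb, sub_self]

/-! ### The maximal error. -/

section MaxError

variable {u v : ℝ} {f s : ℝ → ℝ}

theorem maxError_nonneg (u v : ℝ) (f s : ℝ → ℝ) : 0 ≤ maxError u v f s :=
  Real.iSup_nonneg fun _ => abs_nonneg _

theorem maxError_le {C : ℝ} (hC : 0 ≤ C) (h : ∀ t ∈ Icc u v, |s t - f t| ≤ C) :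
    maxError u v f s ≤ C :=
  Real.iSup_le (fun t => h t t.2) hC

theorem abs_sub_le_maxError (hs : ContinuousOn s (Icc u v)) (hf : ContinuousOn f (Icc u v)) {t : ℝ}
    (ht : t ∈ Icc u v) : |s t - f t| ≤ maxError u v f s := by
  refine le_ciSup (f := fun t : Icc u v => |s t - f t|) ?_ ⟨t, ht⟩
  obtain ⟨C, hC⟩ := isCompact_Icc.exists_bound_of_continuousOn (hs.sub hf)
  exact ⟨C, by rintro _ ⟨y, rfl⟩; exact hC y y.2⟩

theorem maxError_mono {u' v' : ℝ} (hs : ContinuousOn s (Icc u v)) (hf : ContinuousOn f (Icc u v))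
    (hsub : Icc u' v' ⊆ Icc u v) : maxError u' v' f s ≤ maxError u v f s :=
  maxError_le (maxError_nonneg u v f s) fun _ ht => abs_sub_le_maxError hs hf (hsub ht)

end MaxError

/-! ### Lower bound on the end intervals. -/

theorem taylor_secondDeriv_isLittleO {a b p : ℝ} (hp : p ∈ Icc a b) {f : ℝ → ℝ}
    (hf : ContDiffOn ℝ 2 f (Icc a b)) :
    (fun t => f t - (f p + derivWithin f (Icc a b) p * (t - p) +
      secondDeriv a b f p / 2 * (t - p) ^ 2)) =o[𝓝[Icc a b] p] fun t => (t - p) ^ 2 := by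
  refine (taylor_isLittleO (n := 2) (convex_Icc a b) hp hf).congr_left fun t => ?_
  simp [taylor_within_apply, iteratedDerivWithin_one, secondDeriv,
    Nat.factorial]
  ring

/-- A function with vanishing four-point difference `2g(p) - 5g(p+k) + 4g(p+2k) - g(p+3k)` cannot
approximate `f` near `p` to an order better than two when `f''(p) ≠ 0`. -/
theorem exists_le_error_of_four_point_eq_zero {a b p : ℝ} (hp : p ∈ Icc a b) {f : ℝ → ℝ}
    (hf : ContDiffOn ℝ 2 f (Icc a b)) (hA : secondDeriv a b f p ≠ 0) :
    ∃ c h₀ : ℝ, 0 < c ∧ 0 < h₀ ∧ ∀ (k E : ℝ) (s : ℝ → ℝ), |3 * k| ≤ h₀ → p + 3 * k ∈ Icc a b →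
      s p = f p → s (p + 3 * k) = f (p + 3 * k) → |s (p + k) - f (p + k)| ≤ E →
      |s (p + 2 * k) - f (p + 2 * k)| ≤ E →
      2 * s p - 5 * s (p + k) + 4 * s (p + 2 * k) - s (p + 3 * k) = 0 → c * (3 * k) ^ 2 ≤ E := by
  set A := secondDeriv a b f p with hAdef
  set D := derivWithin f (Icc a b) p
  have hA' : 0 < |A| := abs_pos.2 hA
  have hO := (taylor_secondDeriv_isLittleO hp hf).def (show 0 < |A| / 60 by positivity)
  rw [← hAdef] at hO
  obtain ⟨ε, hε, hball⟩ := Metric.mem_nhdsWithin_iff.1 hO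
  have hR : ∀ y, |y - p| < ε → y ∈ Icc a b →
      |f y - (f p + D * (y - p) + A / 2 * (y - p) ^ 2)| ≤ |A| / 60 * (y - p) ^ 2 := fun y h1 h2 => by
    have := hball ⟨by rwa [Metric.mem_ball, Real.dist_eq], h2⟩
    simpa using this
  -- The Taylor remainders contribute at most `(5 + 4 * 4 + 9) |A| / 60 = |A| / 2` times `k ^ 2` and
  -- the errors at most `9 * E`, so `|A| * k ^ 2 ≤ 18 * E`; rewriting with `(3 * k) ^ 2` gives `162
  -- = 18 * 9`.
  refine ⟨|A| / 162, ε / 2, by positivity, by positivity, ?_⟩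
  intro k E s hk h3 s0 s3 e1 e2 hs
  have hmem : ∀ θ : ℝ, 0 ≤ θ → θ ≤ 1 → p + θ * (3 * k) ∈ Icc a b ∧ |θ * (3 * k)| < ε :=
    fun θ h0 h1 => by
      refine ⟨?_, ?_⟩
      · have := (convex_Icc a b) hp h3 (sub_nonneg.2 h1) h0 (by ring)
        simp only [smul_eq_mul] at this
        convert this using 1
        ring
      · rw [abs_mul, abs_of_nonneg h0]
        nlinarith [abs_nonneg (3 * k)]
  have key : ∀ θ : ℝ, 0 ≤ θ → θ ≤ 3 →
      |f (p + θ * k) - (f p + D * (θ * k) + A / 2 * (θ * k) ^ 2)| ≤ |A| / 60 * (θ * k) ^ 2 :=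
    fun θ h0 h1 => by
      obtain ⟨m1, m2⟩ := hmem (θ / 3) (by positivity) (by linarith)
      rw [show θ / 3 * (3 * k) = θ * k by ring] at m1 m2
      have := hR (p + θ * k) (by simpa using m2) m1
      simpa using this
  have r1 := key 1 (by norm_num) (by norm_num)
  have r2 := key 2 (by norm_num) (by norm_num)
  have r3 := key 3 (by norm_num) (by norm_num)
  rw [one_mul] at r1
  have hid : A * k ^ 2 = 5 * (s (p + k) - f (p + k)) - 4 * (s (p + 2 * k) - f (p + 2 * k)) +
      5 * (f (p + k) - (f p + D * k + A / 2 * k ^ 2)) -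
      4 * (f (p + 2 * k) - (f p + D * (2 * k) + A / 2 * (2 * k) ^ 2)) +
      (f (p + 3 * k) - (f p + D * (3 * k) + A / 2 * (3 * k) ^ 2)) := by
    rw [s0, s3] at hs
    linear_combination hs
  have hle : |A| * k ^ 2 ≤ 9 * E + |A| / 60 * (30 * k ^ 2) := by
    have : |A| * k ^ 2 = |A * k ^ 2| := by rw [abs_mul, abs_of_nonneg (sq_nonneg k)]
    rw [this, hid]
    rw [abs_le] at e1 e2 r1 r2 r3 ⊢
    constructor <;> linarith [r1.1, r1.2, r2.1, r2.2, r3.1, r3.2]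
  nlinarith

theorem four_point_eq_zero_of_secondDeriv_eq_zero {a b u v w k : ℝ} (hab : a < b) (huv : u < v)
    (hsub : Icc u v ⊆ Icc a b) {s : ℝ → ℝ} (hs : ContDiffOn ℝ 2 s (Icc a b))
    {p : Polynomial ℝ} (hp : p.natDegree ≤ 3) (hsp : ∀ t ∈ Icc u v, s t = p.eval t)
    (hw : secondDeriv a b s w = 0) (h0 : w ∈ Icc u v) (h1 : w + k ∈ Icc u v)
    (h2 : w + 2 * k ∈ Icc u v) (h3 : w + 3 * k ∈ Icc u v) :
    2 * s w - 5 * s (w + k) + 4 * s (w + 2 * k) - s (w + 3 * k) = 0 := by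
  rw [secondDeriv_eqOn_polynomial hab huv hsub hs hsp h0] at hw
  rw [hsp _ h0, hsp _ h1, hsp _ h2, hsp _ h3]
  obtain ⟨c₀, c₁, c₂, c₃, hc⟩ := Polynomial.exists_eval_eq_of_natDegree_le_three hp
  simp only [hc] at *
  linear_combination k ^ 2 * hw

theorem exists_mul_sq_le_maxError_first {a b : ℝ} (hab : a < b) {f : ℝ → ℝ}
    (hf : ContDiffOn ℝ 2 f (Icc a b)) (hA : secondDeriv a b f a ≠ 0) :
    ∃ c h₀ : ℝ, 0 < c ∧ 0 < h₀ ∧ ∀ (n : ℕ) (x : ℕ → ℝ) (s : ℝ → ℝ), 0 < n → IsMesh a b n x →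
      IsNaturalSpline a b n x f s → meshSize n x ≤ h₀ →
      c * (x 1 - x 0) ^ 2 ≤ maxError (x 0) (x 1) f s := by
  obtain ⟨c, h₀, hc, hh, H⟩ := exists_le_error_of_four_point_eq_zero (left_mem_Icc.2 hab.le) hf hA
  refine ⟨c, h₀, hc, hh, fun n x s hn hx hs hm => ?_⟩
  have hlt : x 0 < x 1 := hx.lt 0 hn
  have hsub : Icc (x 0) (x 1) ⊆ Icc a b := hx.Icc_subset hn
  obtain ⟨p, hp, hsp⟩ := hs.spline.cubic 0 hn
  have hk : x 1 - x 0 ≤ h₀ := (IsMesh.sub_le_meshSize n x hn).trans hm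
  have hE : ∀ t ∈ Icc (x 0) (x 1), |s t - f t| ≤ maxError (x 0) (x 1) f s := fun t ht =>
    abs_sub_le_maxError (hs.spline.contDiffOn.continuousOn.mono hsub)
      (hf.continuousOn.mono hsub) ht
  have i0 := hs.interp 0 (by omega)
  have i1 := hs.interp 1 hn
  have hw := hs.natural_left
  simp only [← hx.left, zero_add] at *
  obtain ⟨k, hk3⟩ : ∃ k, x 1 = x 0 + 3 * k := ⟨(x 1 - x 0) / 3, by ring⟩
  have m1 : x 0 + k ∈ Icc (x 0) (x 1) := ⟨by linarith, by linarith⟩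
  have m2 : x 0 + 2 * k ∈ Icc (x 0) (x 1) := ⟨by linarith, by linarith⟩
  have m3 : x 0 + 3 * k ∈ Icc (x 0) (x 1) := ⟨by linarith, by linarith⟩
  have := H k (maxError (x 0) (x 1) f s) s (by rw [abs_of_pos] <;> linarith) (hsub m3) i0
    (hk3 ▸ i1) (hE _ m1) (hE _ m2)
    (four_point_eq_zero_of_secondDeriv_eq_zero hab hlt hsub hs.spline.contDiffOn hp hsp hw
      (left_mem_Icc.2 hlt.le) m1 m2 m3)
  rwa [show x 1 - x 0 = 3 * k by linarith]

theorem exists_mul_sq_le_maxError_last {a b : ℝ} (hab : a < b) {f : ℝ → ℝ}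
    (hf : ContDiffOn ℝ 2 f (Icc a b)) (hA : secondDeriv a b f b ≠ 0) :
    ∃ c h₀ : ℝ, 0 < c ∧ 0 < h₀ ∧ ∀ (n : ℕ) (x : ℕ → ℝ) (s : ℝ → ℝ), 0 < n → IsMesh a b n x →
      IsNaturalSpline a b n x f s → meshSize n x ≤ h₀ →
      c * (x n - x (n - 1)) ^ 2 ≤ maxError (x (n - 1)) (x n) f s := by
  obtain ⟨c, h₀, hc, hh, H⟩ := exists_le_error_of_four_point_eq_zero (right_mem_Icc.2 hab.le) hf hA
  refine ⟨c, h₀, hc, hh, fun n x s hn hx hs hm => ?_⟩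
  obtain ⟨n, rfl⟩ : ∃ m, n = m + 1 := ⟨n - 1, by omega⟩
  rw [Nat.add_sub_cancel]
  have hlt : x n < x (n + 1) := hx.lt n (by omega)
  have hsub : Icc (x n) (x (n + 1)) ⊆ Icc a b := hx.Icc_subset (by omega)
  obtain ⟨p, hp, hsp⟩ := hs.spline.cubic n (by omega)
  have hk : x (n + 1) - x n ≤ h₀ := (IsMesh.sub_le_meshSize (n + 1) x (by omega)).trans hm
  have hE : ∀ t ∈ Icc (x n) (x (n + 1)), |s t - f t| ≤ maxError (x n) (x (n + 1)) f s :=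
    fun t ht => abs_sub_le_maxError (hs.spline.contDiffOn.continuousOn.mono hsub)
      (hf.continuousOn.mono hsub) ht
  have i0 := hs.interp (n + 1) le_rfl
  have i1 := hs.interp n (by omega)
  have hw := hs.natural_right
  rw [← hx.right] at H hw hsub hab hf
  rw [← hx.right] at hs
  -- Here `k` is negative: the four points run leftwards from `b`.
  obtain ⟨k, hk3⟩ : ∃ k, x n = x (n + 1) + 3 * k := ⟨(x n - x (n + 1)) / 3, by ring⟩
  have m1 : x (n + 1) + k ∈ Icc (x n) (x (n + 1)) := ⟨by linarith, by linarith⟩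
  have m2 : x (n + 1) + 2 * k ∈ Icc (x n) (x (n + 1)) := ⟨by linarith, by linarith⟩
  have m3 : x (n + 1) + 3 * k ∈ Icc (x n) (x (n + 1)) := ⟨by linarith, by linarith⟩
  have := H k (maxError (x n) (x (n + 1)) f s) s (by rw [abs_of_neg] <;> linarith) (hsub m3) i0
    (hk3 ▸ i1) (hE _ m1) (hE _ m2)
    (four_point_eq_zero_of_secondDeriv_eq_zero hab hlt hsub hs.spline.contDiffOn hp hsp hw
      (right_mem_Icc.2 hlt.le) m1 m2 m3)
  rw [show x (n + 1) - x n = -(3 * k) by linarith]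
  linarith [neg_sq (3 * k)]

/-! ### Meshes with a prescribed size attained at an end interval. -/

theorem exists_nat_four_le_mul_lt_le {l h : ℝ} (hh : 0 < h) (hl : 3 * h < l) :
    ∃ N : ℕ, 4 ≤ N ∧ l ≤ N * h ∧ ∀ i < N, i * h < l := by
  refine ⟨⌈l / h⌉₊, ?_, ?_, fun i hi => ?_⟩
  · exact Nat.lt_ceil.2 (by push_cast; rwa [lt_div_iff₀ hh])
  · rw [← div_le_iff₀ hh]; exact Nat.le_ceil _
  · rw [← lt_div_iff₀ hh]; exact Nat.lt_ceil.1 hi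

theorem exists_mesh_first_eq {a b h : ℝ} (hh : 0 < h) (hl : 3 * h < b - a) :
    ∃ (n : ℕ) (x : ℕ → ℝ), 4 ≤ n ∧ IsMesh a b n x ∧ meshSize n x = h ∧ x 1 - x 0 = h := by
  obtain ⟨N, hN, h1, h2⟩ := exists_nat_four_le_mul_lt_le hh hl
  -- Equal steps `h` from `a`, clipped at `b`: only the last interval can be shorter.
  set x : ℕ → ℝ := fun i => min (a + i * h) b with hxdef
  have hx : ∀ i < N, x i = a + i * h := fun i hi => min_eq_left (by linarith [h2 i hi])
  have hx0 : x 0 = a := by simpa using hx 0 (by omega)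
  have h10 : x 1 - x 0 = h := by rw [hx0, hx 1 (by omega)]; simp
  refine ⟨N, x, hN, ⟨hx0, min_eq_right (by linarith), fun i hi => ?_⟩, le_antisymm ?_ ?_, h10⟩
  · rw [hx i hi]
    refine lt_min ?_ (by linarith [h2 i hi])
    push_cast
    linarith
  · have : Nonempty (Fin N) := ⟨⟨0, by omega⟩⟩
    refine ciSup_le fun i => ?_
    rw [hx i i.2]
    have := min_le_left (a + ((i + 1 : ℕ) : ℝ) * h) b
    push_cast at this
    simp only [hxdef]
    push_cast
    linarith
  · rw [← h10]
    exact IsMesh.sub_le_meshSize N x (by omega)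

theorem exists_mesh_last_eq {a b h : ℝ} (hh : 0 < h) (hl : 3 * h < b - a) :
    ∃ (n : ℕ) (x : ℕ → ℝ), 4 ≤ n ∧ IsMesh a b n x ∧ meshSize n x = h ∧ x n - x (n - 1) = h := by
  obtain ⟨N, hN, h1, h2⟩ := exists_nat_four_le_mul_lt_le hh hl
  -- Mirror image: equal steps back from `b`, so only the first interval can be shorter.
  set x : ℕ → ℝ := fun i => max a (b - (N - i) * h) with hxdef
  have hx : ∀ i < N, x (i + 1) = b - (N - (i + 1)) * h := fun i hi => by
    have := h2 (N - (i + 1)) (by omega)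
    rw [Nat.cast_sub (by omega)] at this
    push_cast at this
    simp only [hxdef]
    push_cast
    exact max_eq_right (by linarith)
  have hab : a < b := by linarith
  have hxN : x N = b := by simp [hxdef, hab.le]
  have h10 : x N - x (N - 1) = h := by
    have := hx (N - 2) (by omega)
    rw [show N - 2 + 1 = N - 1 by omega, Nat.cast_sub (by omega)] at this
    rw [hxN, this]
    push_cast
    ring
  refine ⟨N, x, hN, ⟨max_eq_left ?_, hxN, fun i hi => ?_⟩, le_antisymm ?_ ?_, h10⟩
  · push_cast; linarith
  · rw [hx i hi]
    refine max_lt ?_ (by linarith)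
    have h3 := h2 (N - (i + 1)) (by omega)
    rw [Nat.cast_sub (by omega)] at h3
    push_cast at h3
    linarith
  · have : Nonempty (Fin N) := ⟨⟨0, by omega⟩⟩
    refine ciSup_le fun i => ?_
    rw [hx i i.2]
    have := le_max_right a (b - (N - (i : ℕ)) * h)
    simp only [hxdef]
    linarith
  · have := IsMesh.sub_le_meshSize N x (i := N - 1) (by omega)
    rwa [show N - 1 + 1 = N by omega, h10] at this

/-! ### Exact order of the error. -/

theorem exists_maxError_le {a b : ℝ} (hab : a < b) {f : ℝ → ℝ}
    (hf : ContDiffOn ℝ 2 f (Icc a b)) :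
    ∃ C : ℝ, 0 < C ∧ ∀ (n : ℕ) (x : ℕ → ℝ) (s : ℝ → ℝ), 0 < n → IsMesh a b n x →
      IsNaturalSpline a b n x f s → maxError a b f s ≤ C * meshSize n x ^ 2 := by
  obtain ⟨K, hK, hfK⟩ := exists_hasCurvatureBound hab hf
  -- `K` may be zero, and the constant has to be positive.
  refine ⟨K + 1, by linarith, fun n x s hn hx hs => maxError_le (by positivity) fun t ht =>
    (hs.abs_sub_le hab hK hfK hn hx ht).trans ?_⟩
  gcongr
  linarith

theorem worstError_isTheta {a b : ℝ} (hab : a < b) {f : ℝ → ℝ} (hf : ContDiffOn ℝ 2 f (Icc a b))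
    (hne : secondDeriv a b f a ≠ 0 ∨ secondDeriv a b f b ≠ 0) :
    worstError a b f =Θ[𝓝[>] (0 : ℝ)] fun h : ℝ => h ^ 2 := by
  obtain ⟨C, hC, hup⟩ := exists_maxError_le hab hf
  have hbound : ∀ h : ℝ, ∀ e ∈ {e : ℝ | ∃ (n : ℕ) (x : ℕ → ℝ) (s : ℝ → ℝ), 4 ≤ n ∧
      IsMesh a b n x ∧ meshSize n x = h ∧ IsNaturalSpline a b n x f s ∧ e = maxError a b f s},
      0 ≤ e ∧ e ≤ C * h ^ 2 := by
    rintro h _ ⟨n, x, s, hn, hx, rfl, hs, rfl⟩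
    exact ⟨maxError_nonneg _ _ _ _, hup n x s (by omega) hx hs⟩
  have hnonneg : ∀ h, 0 ≤ worstError a b f h := fun h => Real.sSup_nonneg fun e he =>
    (hbound h e he).1
  have hle : ∀ (n : ℕ) (x : ℕ → ℝ) (s : ℝ → ℝ), 4 ≤ n → IsMesh a b n x →
      IsNaturalSpline a b n x f s → maxError a b f s ≤ worstError a b f (meshSize n x) :=
    fun n x s hn hx hs => le_csSup ⟨_, fun e he => (hbound _ e he).2⟩
      ⟨n, x, s, hn, hx, rfl, hs, rfl⟩
  have hlow : ∃ c h₀ : ℝ, 0 < c ∧ 0 < h₀ ∧ ∀ h, 0 < h → 3 * h < b - a → h ≤ h₀ →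
      c * h ^ 2 ≤ worstError a b f h := by
    rcases hne with hA | hB
    · obtain ⟨c, h₀, hc, hh, H⟩ := exists_mul_sq_le_maxError_first hab hf hA
      refine ⟨c, h₀, hc, hh, fun h h1 h2 h3 => ?_⟩
      obtain ⟨n, x, hn, hx, rfl, hd⟩ := exists_mesh_first_eq h1 h2
      obtain ⟨s, hs⟩ := exists_isNaturalSpline hab (by omega) hx f
      rw [← hd]
      exact (H n x s (by omega) hx hs h3).trans ((maxError_mono
        hs.spline.contDiffOn.continuousOn hf.continuousOn
        (hx.Icc_subset (i := 0) (by omega))).trans (hd ▸ hle n x s hn hx hs))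
    · obtain ⟨c, h₀, hc, hh, H⟩ := exists_mul_sq_le_maxError_last hab hf hB
      refine ⟨c, h₀, hc, hh, fun h h1 h2 h3 => ?_⟩
      obtain ⟨n, x, hn, hx, rfl, hd⟩ := exists_mesh_last_eq h1 h2
      obtain ⟨s, hs⟩ := exists_isNaturalSpline hab (by omega) hx f
      have hsub := hx.Icc_subset (i := n - 1) (by omega)
      rw [show n - 1 + 1 = n by omega] at hsub
      have h4 := H n x s (by omega) hx hs h3
      rw [hd] at h4
      exact h4.trans ((maxError_mono hs.spline.contDiffOn.continuousOn hf.continuousOn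
        hsub).trans (hle n x s hn hx hs))
  obtain ⟨c, h₀, hc, hh, hlow⟩ := hlow
  refine ⟨IsBigO.of_bound C (Eventually.of_forall fun h => ?_), IsBigO.of_bound c⁻¹ ?_⟩
  · rw [Real.norm_of_nonneg (hnonneg h), Real.norm_of_nonneg (sq_nonneg h)]
    -- This also covers values of `h` that no mesh attains, where the supremum of the empty set is
    -- `0`.
    exact Real.sSup_le (fun e he => (hbound h e he).2) (by positivity)
  · have hpos : 0 < min h₀ ((b - a) / 3) := lt_min hh (by linarith)
    filter_upwards [Ioo_mem_nhdsGT hpos] with h hmem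
    have h2 := lt_min_iff.1 hmem.2
    rw [Real.norm_of_nonneg (hnonneg h), Real.norm_of_nonneg (sq_nonneg h),
      ← div_eq_inv_mul, le_div_iff₀ hc, mul_comm]
    exact hlow h hmem.1 (by linarith [h2.2]) h2.1.le

theorem corollary1 (a b : ℝ) (hab : a < b) (f : ℝ → ℝ)
    (hf : ContDiffOn ℝ 4 f (Icc a b))
    (hne : 0 < |secondDeriv a b f a| + |secondDeriv a b f b|) :
    -- the natural spline exists and is unique on `[a, b]`
    (∀ (n : ℕ) (x : ℕ → ℝ), 4 ≤ n → IsMesh a b n x →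
      ∃ s : ℝ → ℝ, IsNaturalSpline a b n x f s ∧
        ∀ s' : ℝ → ℝ, IsNaturalSpline a b n x f s' → EqOn s' s (Icc a b)) ∧
    -- upper bound of order `h ^ 2` on every mesh
    (∃ C : ℝ, 0 < C ∧ ∀ (n : ℕ) (x : ℕ → ℝ) (s : ℝ → ℝ), 4 ≤ n → IsMesh a b n x →
      IsNaturalSpline a b n x f s → maxError a b f s ≤ C * meshSize n x ^ 2) ∧
    -- lower bound on every fine mesh, of second order in the length of the end interval
    (∃ c h₀ : ℝ, 0 < c ∧ 0 < h₀ ∧ ∀ (n : ℕ) (x : ℕ → ℝ) (s : ℝ → ℝ), 4 ≤ n → IsMesh a b n x →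
      IsNaturalSpline a b n x f s → meshSize n x ≤ h₀ →
      (secondDeriv a b f a ≠ 0 →
        c * (x 1 - x 0) ^ 2 ≤ maxError (x 0) (x 1) f s) ∧
      (secondDeriv a b f b ≠ 0 →
        c * (x n - x (n - 1)) ^ 2 ≤ maxError (x (n - 1)) (x n) f s)) ∧
    -- the error, in the worst case over meshes of size `h`, is of the exact order `h ^ 2`
    (worstError a b f =Θ[𝓝[>] (0 : ℝ)] fun h : ℝ => h ^ 2) := by
  have hf2 : ContDiffOn ℝ 2 f (Icc a b) := hf.of_le (by norm_num)
  refine ⟨fun n x hn hx => ?_, ?_, ?_, worstError_isTheta hab hf2 ?_⟩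
  · obtain ⟨s, hs⟩ := exists_isNaturalSpline hab (by omega) hx f
    exact ⟨s, hs, fun s' hs' => hs'.eqOn hs hab (by omega) hx⟩
  · obtain ⟨C, hC, H⟩ := exists_maxError_le hab hf2
    exact ⟨C, hC, fun n x s hn => H n x s (by omega)⟩
  · obtain ⟨c, h₀, hc, hh, H⟩ : ∃ c h₀ : ℝ, 0 < c ∧ 0 < h₀ ∧ ∀ (n : ℕ) (x : ℕ → ℝ) (s : ℝ → ℝ),
        0 < n → IsMesh a b n x → IsNaturalSpline a b n x f s → meshSize n x ≤ h₀ →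
        secondDeriv a b f a ≠ 0 → c * (x 1 - x 0) ^ 2 ≤ maxError (x 0) (x 1) f s := by
      by_cases hA : secondDeriv a b f a = 0
      -- The claim at this end is vacuous, so any positive constants serve.
      · exact ⟨1, 1, one_pos, one_pos, fun _ _ _ _ _ _ _ h => absurd hA h⟩
      · obtain ⟨c, h₀, hc, hh, H⟩ := exists_mul_sq_le_maxError_first hab hf2 hA
        exact ⟨c, h₀, hc, hh, fun n x s h1 h2 h3 h4 _ => H n x s h1 h2 h3 h4⟩
    obtain ⟨c', h₀', hc', hh', H'⟩ : ∃ c h₀ : ℝ, 0 < c ∧ 0 < h₀ ∧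
        ∀ (n : ℕ) (x : ℕ → ℝ) (s : ℝ → ℝ),
        0 < n → IsMesh a b n x → IsNaturalSpline a b n x f s → meshSize n x ≤ h₀ →
        secondDeriv a b f b ≠ 0 → c * (x n - x (n - 1)) ^ 2 ≤ maxError (x (n - 1)) (x n) f s := by
      by_cases hB : secondDeriv a b f b = 0
      · exact ⟨1, 1, one_pos, one_pos, fun _ _ _ _ _ _ _ h => absurd hB h⟩
      · obtain ⟨c, h₀, hc, hh, H⟩ := exists_mul_sq_le_maxError_last hab hf2 hB
        exact ⟨c, h₀, hc, hh, fun n x s h1 h2 h3 h4 _ => H n x s h1 h2 h3 h4⟩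
    refine ⟨min c c', min h₀ h₀', lt_min hc hc', lt_min hh hh', fun n x s hn hx hs hm =>
      ⟨fun hA => le_trans ?_ (H n x s (by omega) hx hs (hm.trans (min_le_left _ _)) hA),
        fun hB => le_trans ?_ (H' n x s (by omega) hx hs (hm.trans (min_le_right _ _)) hB)⟩⟩
    · exact mul_le_mul_of_nonneg_right (min_le_left _ _) (sq_nonneg _)
    · exact mul_le_mul_of_nonneg_right (min_le_right _ _) (sq_nonneg _)
  · by_contra! h
    simp [h.1, h.2] at hne
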